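/- Let $q$ be an odd prime power and let $E_q$ be either the field $\mathbf{F}_{q^2}$ (unitary case) or the ring $\mathbf{F}_q\oplus\mathbf{F}_q$ (linear case). Let $n>2$ and let $t_0,\dots,t_{n+1}\in E_q^\times$ satisfy $$t_0t_1\cdots t_n=1,\qquad t_0-1\in E_q^\times,\qquad t_{n+1}-1\in E_q^\times .$$ Let $P_{n+2}$ be the pure braid group on the strands $0,\dots,n+1$, that is, the kernel of the homomorphism from Artin's braid group (with standard generators $s_0,\dots,s_n$) to the symmetric group. Let $$\bar g_{n+1}(t_0,\dots,t_{n+1}) : P_{n+2}\to \mathrm{GL}_{n+1}(E_q)$$ be the reduced Gassner representation specialized at $T_i\mapsto t_i$; it has a basis $\varepsilon_0,\dots,\varepsilon_n$ in which $s_i^2$ acts by $\varepsilon_{i-1}\mapsto\varepsilon_{i-1}+t_i(1-t_{i+1})\varepsilon_i$, $\ \varepsilon_i\mapsto t_it_{i+1}\varepsilon_i$, $\ \varepsilon_{i+1}\mapsto\varepsilon_{i+1}+(1-t_i)\varepsilon_i$, and $\varepsilon_j\mapsto\varepsilon_j$ for all other $j$. Explicitly, let $\beta\in P_{n+2}$ act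 on the free group on $x_0,\dots,x_{n+1}$ through $s_i: x_i\mapsto x_ix_{i+1}x_i^{-1},\ x_{i+1}\mapsto x_i$, and write $\beta(x_k)=g_kx_kg_k^{-1}$. On the free module with basis $f_0,\dots,f_{n+1}$ let $\beta$ act by $$f_k\mapsto\sum_j(1-t_j)\frac{\partial g_k}{\partial x_j}(t)\,f_j+g_k(t)\,f_k ,$$ where $\partial/\partial x_j$ are the Fox derivatives, evaluated at $x_i\mapsto t_i$. The reduced representation is the submodule of vectors with coordinate sum zero, with basis $\varepsilon_i=f_{i+1}-f_i$. Then $\bar g_{n+1}(t_0,\dots,t_{n+1})$ is primitive: there is no decomposition of its space $E_q^{\,n+1}$ as a direct sum $V_1\oplus\cdots\oplus V_r$ of $r\ge 2$ nonzero free $E_q$-submodules such that every element of $P_{n+2}$ permutes the set $\{V_1,\dots,V_r\}$. -/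

import Mathlib

/-! ### Artin's braid group and the pure braid group -/

/-- The relators of Artin's presentation of the braid group on `m + 1` strands, with generators
`s 0, …, s (m - 1)`. -/
def braidRels (m : ℕ) : Set (FreeGroup (Fin m)) :=
  {r | ∃ i j : Fin m, (i : ℕ) + 1 < j ∧
      r = FreeGroup.of i * FreeGroup.of j * (FreeGroup.of j * FreeGroup.of i)⁻¹} ∪
  {r | ∃ i j : Fin m, (i : ℕ) + 1 = j ∧
      r = FreeGroup.of i * FreeGroup.of j * FreeGroup.of i *
        (FreeGroup.of j * FreeGroup.of i * FreeGroup.of j)⁻¹}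

/-- Artin's braid group on the `m + 1` strands `0, …, m`. -/
abbrev BraidGroup (m : ℕ) : Type := PresentedGroup (braidRels m)

theorem braid_lift_eq_one {m : ℕ} {G : Type*} [Group G] (f : Fin m → G)
    (hfar : ∀ i j : Fin m, (i : ℕ) + 1 < j → f i * f j = f j * f i)
    (hbraid : ∀ i j : Fin m, (i : ℕ) + 1 = j → f i * f j * f i = f j * f i * f j) :
    ∀ r ∈ braidRels m, FreeGroup.lift f r = 1 := by
  rintro r (⟨i, j, h, rfl⟩ | ⟨i, j, h, rfl⟩)
  · rw [map_mul, map_inv, mul_inv_eq_one]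
    simpa using hfar i j h
  · have := hbraid i j h
    rw [map_mul, map_inv, mul_inv_eq_one]
    simpa using this

theorem fin_far {m : ℕ} {i j : Fin m} (h : (i : ℕ) + 1 < j) :
    i.castSucc ≠ j.castSucc ∧ i.castSucc ≠ j.succ ∧ i.succ ≠ j.castSucc ∧ i.succ ≠ j.succ := by
  refine ⟨?_, ?_, ?_, ?_⟩ <;> (rw [Ne, Fin.ext_iff]; simp; omega)

theorem fin_near {m : ℕ} {i j : Fin m} (h : (i : ℕ) + 1 = j) :
    j.castSucc = i.succ ∧ i.castSucc ≠ j.succ ∧ i.succ ≠ j.succ := by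
  refine ⟨?_, ?_, ?_⟩ <;> (simp only [Ne, Fin.ext_iff, Fin.val_castSucc, Fin.val_succ]; omega)

theorem swap_far {α : Type*} [DecidableEq α] {a b c d : α} (hac : a ≠ c) (had : a ≠ d)
    (hbc : b ≠ c) (hbd : b ≠ d) :
    Equiv.swap a b * Equiv.swap c d = Equiv.swap c d * Equiv.swap a b := by
  ext k
  simp only [Equiv.Perm.mul_apply, Equiv.swap_apply_def]
  grind

theorem swap_braid {α : Type*} [DecidableEq α] {a b d : α} (hab : a ≠ b) (had : a ≠ d)
    (hbd : b ≠ d) :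
    Equiv.swap a b * Equiv.swap b d * Equiv.swap a b =
      Equiv.swap b d * Equiv.swap a b * Equiv.swap b d := by
  ext k
  simp only [Equiv.Perm.mul_apply, Equiv.swap_apply_def]
  grind

/-- The permutation of the strands underlying a braid: `s i` exchanges the strands `i`, `i + 1`. -/
def braidPerm (m : ℕ) : BraidGroup m →* Equiv.Perm (Fin (m + 1)) :=
  PresentedGroup.toGroup (f := fun i : Fin m => Equiv.swap i.castSucc i.succ)
    (braid_lift_eq_one _
      (fun _ _ h => swap_far (fin_far h).1 (fin_far h).2.1 (fin_far h).2.2.1 (fin_far h).2.2.2)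
      (fun i _ h => by
        rw [(fin_near h).1]
        exact swap_braid i.castSucc_lt_succ.ne (fin_near h).2.1 (fin_near h).2.2))

/-- The pure braid group on the `m + 1` strands `0, …, m`. -/
abbrev PureBraidGroup (m : ℕ) : Subgroup (BraidGroup m) := (braidPerm m).ker

/-! ### The Gassner representation -/

/-- Vectors with colored coordinates: each strand `k` carries an invertible color `c k` and a
coordinate `y k`. -/
abbrev ColoredVec (R : Type*) [CommRing R] (I : Type*) : Type _ := (I → Rˣ) × (I → R)

section Step

variable {R : Type*} [CommRing R] {I : Type*} [DecidableEq I]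

/-- The colored Burau move at two distinct strands `a`, `b`: the colors are exchanged, and the
coordinates at `a`, `b` become `(1 - c b) y a + y b` and `c b * y a`. -/
def coloredStep (a b : I) (hab : a ≠ b) : Equiv.Perm (ColoredVec R I) where
  toFun x := (x.1 ∘ Equiv.swap a b, fun k =>
    if k = a then (1 - x.1 b) * x.2 a + x.2 b else if k = b then x.1 b * x.2 a else x.2 k)
  invFun x := (x.1 ∘ Equiv.swap a b, fun k =>
    if k = a then ((x.1 a)⁻¹ : Rˣ) * x.2 b
    else if k = b then x.2 a - (1 - x.1 a) * (((x.1 a)⁻¹ : Rˣ) * x.2 b) else x.2 k)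
  left_inv x := by
    refine Prod.ext ?_ ?_
    · funext k; simp
    · funext k
      by_cases ha : k = a
      · subst ha; simp [hab.symm]
      · by_cases hb : k = b
        · subst hb; simp [ha]
        · simp [ha, hb]
  right_inv x := by
    refine Prod.ext ?_ ?_
    · funext k; simp
    · funext k
      by_cases ha : k = a
      · subst ha; simp [hab.symm]
      · by_cases hb : k = b
        · subst hb; simp [ha]
        · simp [ha, hb]

theorem coloredStep_far {a b c d : I} (hab : a ≠ b) (hcd : c ≠ d) (hac : a ≠ c) (had : a ≠ d)
    (hbc : b ≠ c) (hbd : b ≠ d) :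
    coloredStep (R := R) a b hab * coloredStep c d hcd =
      coloredStep c d hcd * coloredStep a b hab := by
  ext x k
  · simp only [coloredStep, Equiv.Perm.mul_apply, Equiv.coe_fn_mk, Function.comp_apply]
    congr 2
    have := congrArg (fun e : Equiv.Perm I => e k) (swap_far hac had hbc hbd)
    simpa using congrArg x.1 this.symm
  · simp only [coloredStep, Equiv.Perm.mul_apply, Equiv.coe_fn_mk, Function.comp_apply,
      Equiv.swap_apply_def]
    grind

theorem coloredStep_braid {a b d : I} (hab : a ≠ b) (had : a ≠ d) (hbd : b ≠ d) :
    coloredStep (R := R) a b hab * coloredStep b d hbd * coloredStep a b hab =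
      coloredStep b d hbd * coloredStep a b hab * coloredStep b d hbd := by
  ext x k
  · simp only [coloredStep, Equiv.Perm.mul_apply, Equiv.coe_fn_mk, Function.comp_apply]
    congr 2
    have := congrArg (fun e : Equiv.Perm I => e k) (swap_braid hab had hbd)
    simpa using congrArg x.1 this
  · simp only [coloredStep, Equiv.Perm.mul_apply, Equiv.coe_fn_mk, Function.comp_apply,
      Equiv.swap_apply_def]
    grind

end Step

section Gassner

variable {R : Type*} [CommRing R] {m : ℕ}

/-- The colored Burau action of the braid group on colored vectors. A braid maps the coordinates
belonging to one coloring linearly to those belonging to the permuted coloring. -/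
def coloredBurau (R : Type*) [CommRing R] (m : ℕ) :
    BraidGroup m →* Equiv.Perm (ColoredVec R (Fin (m + 1))) :=
  PresentedGroup.toGroup
    (f := fun i : Fin m => coloredStep i.castSucc i.succ i.castSucc_lt_succ.ne)
    (braid_lift_eq_one _
      (fun _ _ h => coloredStep_far _ _
        (fin_far h).1 (fin_far h).2.1 (fin_far h).2.2.1 (fin_far h).2.2.2)
      (fun i _ h => by
        simp only [(fin_near h).1]
        exact coloredStep_braid _ (fin_near h).2.1 (fin_near h).2.2))

/-- What the colored Burau action does: it permutes the colors, is linear in the coordinates, and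
preserves the sum of the coordinates. -/
theorem coloredBurau_spec (β : BraidGroup m) :
    (∀ c y, (coloredBurau R m β (c, y)).1 = c ∘ ((braidPerm m β)⁻¹ : Equiv.Perm _)) ∧
    (∀ c (a : R) y z, (coloredBurau R m β (c, a • y + z)).2 =
      a • (coloredBurau R m β (c, y)).2 + (coloredBurau R m β (c, z)).2) ∧
    (∀ c y, ∑ k, (coloredBurau R m β (c, y)).2 k = ∑ k, y k) := by
  have hβ : β ∈ Subgroup.closure (Set.range (PresentedGroup.of (rels := braidRels m))) := by
    rw [PresentedGroup.closure_range_of]; trivial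
  induction hβ using Subgroup.closure_induction with
  | mem x hx =>
    obtain ⟨i, rfl⟩ := hx
    have h1 : coloredBurau R m (PresentedGroup.of i) =
        coloredStep i.castSucc i.succ i.castSucc_lt_succ.ne := PresentedGroup.toGroup.of _
    have h2 : braidPerm m (PresentedGroup.of i) = Equiv.swap i.castSucc i.succ :=
      PresentedGroup.toGroup.of _
    rw [h1, h2]
    refine ⟨fun c y => by simp [coloredStep], fun c a y z => ?_, fun c y => ?_⟩
    · funext k
      simp only [coloredStep, Equiv.coe_fn_mk, Pi.add_apply, Pi.smul_apply, smul_eq_mul]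
      split_ifs <;> ring
    · have hne : i.castSucc ≠ i.succ := i.castSucc_lt_succ.ne
      rw [← sub_eq_zero, ← Finset.sum_sub_distrib,
        Fintype.sum_eq_add i.castSucc i.succ hne]
      · simp [coloredStep, hne.symm]; ring
      · rintro k ⟨h, h'⟩
        simp [coloredStep, h, h']
  | one => simp
  | mul x y _ _ hx hy =>
    obtain ⟨x1, x2, x3⟩ := hx
    obtain ⟨y1, y2, y3⟩ := hy
    have e : ∀ c v, coloredBurau R m y (c, v) =
        (c ∘ ((braidPerm m y)⁻¹ : Equiv.Perm _), (coloredBurau R m y (c, v)).2) :=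
      fun c v => Prod.ext (y1 c v) rfl
    refine ⟨fun c v => ?_, fun c a v w => ?_, fun c v => ?_⟩
    · rw [map_mul, Equiv.Perm.mul_apply, e, x1]
      funext k; simp
    · simp only [map_mul, Equiv.Perm.mul_apply]
      rw [e c (a • v + w), e c v, e c w, y2, x2]
    · rw [map_mul, Equiv.Perm.mul_apply, e, x3, y3]
  | inv x _ hx =>
    obtain ⟨x1, x2, x3⟩ := hx
    have e : ∀ c v, coloredBurau R m x⁻¹ (c, v) =
        (c ∘ braidPerm m x, (coloredBurau R m x⁻¹ (c, v)).2) := by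
      intro c v
      refine Prod.ext ?_ rfl
      have h := x1 (coloredBurau R m x⁻¹ (c, v)).1 (coloredBurau R m x⁻¹ (c, v)).2
      have h' : coloredBurau R m x (coloredBurau R m x⁻¹ (c, v)) = (c, v) := by simp
      rw [Prod.mk.eta, h'] at h
      funext k
      have := congrFun h (braidPerm m x k)
      simpa using this.symm
    have e' : ∀ c v, coloredBurau R m x (c ∘ braidPerm m x, (coloredBurau R m x⁻¹ (c, v)).2) =
        (c, v) := by
      intro c v
      rw [← e]; simp
    refine ⟨fun c v => by rw [e]; simp, fun c a v w => ?_, fun c v => ?_⟩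
    · have h : coloredBurau R m x (c ∘ braidPerm m x, a • (coloredBurau R m x⁻¹ (c, v)).2 +
          (coloredBurau R m x⁻¹ (c, w)).2) = (c, a • v + w) := by
        refine Prod.ext ?_ ?_
        · rw [x1]; funext k; simp
        · rw [x2, e', e']
      rw [← h]; simp
    · rw [← x3 (c ∘ braidPerm m x), e']

theorem coloredBurau_pure (t : Fin (m + 1) → Rˣ) (β : PureBraidGroup m) (y : Fin (m + 1) → R) :
    coloredBurau R m β (t, y) = (t, (coloredBurau R m β (t, y)).2) := by
  refine Prod.ext ?_ rfl
  rw [(coloredBurau_spec (β : BraidGroup m)).1, (MonoidHom.mem_ker.1 β.2)]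
  rfl

/-- The Gassner representation of the pure braid group on `m + 1` strands, specialized at
invertible elements `t 0, …, t m` of `R`: pure braids fix every coloring, so the colored Burau
action restricts to a linear action on the vectors with coloring `t`.

In terms of Fox calculus: let a pure braid `β` act on the free group on `x 0, …, x m` through
`s i : x i ↦ x i * x (i+1) * (x i)⁻¹, x (i+1) ↦ x i`, and write `β (x k) = g * x k * g⁻¹`. Then
the `k`-th standard basis vector `f k` is mapped to
`∑ j, (1 - t j) (∂g/∂x j)(t) • f j + g(t) • f k`; thus `e k = (1 - t k) • f k` is mapped to
`∑ j, (∂β(x k)/∂x j)(t) • e j`. -/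
def gassner (t : Fin (m + 1) → Rˣ) :
    Representation R (PureBraidGroup m) (Fin (m + 1) → R) where
  toFun β :=
    { toFun := fun y => (coloredBurau R m β (t, y)).2
      map_add' := fun y z => by
        simpa using (coloredBurau_spec (β : BraidGroup m)).2.1 t 1 y z
      map_smul' := fun a y => by
        have h0 : (coloredBurau R m β (t, 0)).2 = 0 := by
          have := (coloredBurau_spec (R := R) (β : BraidGroup m)).2.1 t 1 0 0
          simpa using this
        simpa [h0] using (coloredBurau_spec (β : BraidGroup m)).2.1 t a y 0 }
  map_one' := by ext; simp
  map_mul' β γ := by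
    refine LinearMap.ext fun y => ?_
    change (coloredBurau R m (β * γ : BraidGroup m) (t, y)).2 =
      (coloredBurau R m β (t, (coloredBurau R m γ (t, y)).2)).2
    rw [map_mul, Equiv.Perm.mul_apply, coloredBurau_pure t γ y]

/-- The space of the reduced Gassner representation: vectors with coordinate sum zero. It is free
with basis `ε i = f (i+1) - f i`, `i = 0, …, m - 1`. -/
def reducedSpace (R : Type*) [CommRing R] (m : ℕ) : Submodule R (Fin (m + 1) → R) :=
  LinearMap.ker (∑ k, LinearMap.proj k : (Fin (m + 1) → R) →ₗ[R] R)

theorem mem_reducedSpace {y : Fin (m + 1) → R} : y ∈ reducedSpace R m ↔ ∑ k, y k = 0 := by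
  simp [reducedSpace]

/-- The reduced Gassner representation of the pure braid group on the strands `0, …, m`,
specialized at invertible elements `t 0, …, t m` of `R`; it has rank `m`. -/
def reducedGassner (t : Fin (m + 1) → Rˣ) :
    Representation R (PureBraidGroup m) (reducedSpace R m) :=
  (gassner t).subrepresentation (reducedSpace R m) fun β y hy => by
    rw [Submodule.mem_comap, mem_reducedSpace]
    exact ((coloredBurau_spec (β : BraidGroup m)).2.2 t y).trans (mem_reducedSpace.1 hy)

/-- The vector `ε i = f (i+1) - f i` of the reduced Gassner representation. -/
def epsilon (R : Type*) [CommRing R] {m : ℕ} (i : Fin m) : reducedSpace R m :=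
  ⟨Pi.single i.succ 1 - Pi.single i.castSucc 1, by
    rw [mem_reducedSpace]; simp [Finset.sum_sub_distrib]⟩

/-- The pure braid `s i ^ 2`. -/
def pureGen {m : ℕ} (i : Fin m) : PureBraidGroup m :=
  ⟨PresentedGroup.of i ^ 2, by
    rw [MonoidHom.mem_ker, map_pow]
    have h2 : braidPerm m (PresentedGroup.of i) = Equiv.swap i.castSucc i.succ :=
      PresentedGroup.toGroup.of _
    rw [h2, pow_two, Equiv.swap_mul_self]⟩

/-- The standard matrix of `s i ^ 2` in the vectors `ε j`: it fixes `ε j` for `j` different from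
`i - 1`, `i`, `i + 1`, and maps
`ε (i-1) ↦ ε (i-1) + t i (1 - t (i+1)) ε i`, `ε i ↦ t i t (i+1) ε i`,
`ε (i+1) ↦ ε (i+1) + (1 - t i) ε i`. -/
theorem reducedGassner_pureGen_epsilon (t : Fin (m + 1) → Rˣ) (i j : Fin m) :
    reducedGassner t (pureGen i) (epsilon R j) =
      if j = i then ((t i.castSucc : R) * t i.succ) • epsilon R i
      else if (j : ℕ) + 1 = i then
        epsilon R j + ((t i.castSucc : R) * (1 - t i.succ)) • epsilon R i
      else if (i : ℕ) + 1 = j then epsilon R j + (1 - t i.castSucc : R) • epsilon R i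
      else epsilon R j := by
  have h1 : coloredBurau R m (PresentedGroup.of i) =
      coloredStep i.castSucc i.succ i.castSucc_lt_succ.ne := PresentedGroup.toGroup.of _
  have key : ((reducedGassner t (pureGen i) (epsilon R j) : reducedSpace R m) :
      Fin (m + 1) → R) = (coloredStep i.castSucc i.succ i.castSucc_lt_succ.ne
        (coloredStep i.castSucc i.succ i.castSucc_lt_succ.ne (t, (epsilon R j).1))).2 := by
    rw [← h1, ← Equiv.Perm.mul_apply, ← map_mul, ← pow_two]
    rfl
  have hne : i.succ ≠ i.castSucc := i.castSucc_lt_succ.ne'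
  apply Subtype.ext
  rw [key]
  funext k
  split_ifs with hj hj' hj''
  · subst hj
    by_cases ha : k = j.castSucc
    · subst ha; simp [coloredStep, epsilon, Pi.single_apply, hne, hne.symm]; ring
    · by_cases hb : k = j.succ
      · subst hb; simp [coloredStep, epsilon, Pi.single_apply, hne, hne.symm]
      · simp [coloredStep, epsilon, Pi.single_apply, ha, hb]
  · obtain ⟨e1, e2, e3⟩ := fin_near hj'
    have e4 : j.castSucc ≠ i.castSucc := by rw [e1]; exact j.castSucc_lt_succ.ne
    by_cases ha : k = i.castSucc
    · subst ha; simp [coloredStep, epsilon, Pi.single_apply, e1, e2.symm, e3,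
        e3.symm, j.castSucc_lt_succ.ne']; ring
    · by_cases hb : k = i.succ
      · subst hb; simp [coloredStep, epsilon, Pi.single_apply, e1, e2.symm, e3.symm,
          j.castSucc_lt_succ.ne']
      · simp [coloredStep, epsilon, Pi.single_apply, ha, hb]
  · obtain ⟨e1, e2, e3⟩ := fin_near hj''
    by_cases ha : k = i.castSucc
    · subst ha; simp [coloredStep, epsilon, Pi.single_apply, hne, hne.symm, e1, e2, e3]
    · by_cases hb : k = i.succ
      · subst hb; simp [coloredStep, epsilon, Pi.single_apply, hne, hne.symm, e1, e2, e3]; ring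
      · simp [coloredStep, epsilon, Pi.single_apply, ha, hb]
  · have e1 : i.castSucc ≠ j.castSucc := fun h => hj (Fin.castSucc_injective _ h).symm
    have e2 : i.succ ≠ j.succ := fun h => hj (Fin.succ_injective _ h).symm
    have e3 : i.castSucc ≠ j.succ := fun h => hj' (by simpa using (congrArg Fin.val h).symm)
    have e4 : i.succ ≠ j.castSucc := fun h => hj'' (by simpa using congrArg Fin.val h)
    by_cases ha : k = i.castSucc
    · subst ha; simp [coloredStep, epsilon, Pi.single_apply, hne, e1, e2, e3, e4]
    · by_cases hb : k = i.succ
      · subst hb; simp [coloredStep, epsilon, Pi.single_apply, hne, e1, e2, e3, e4]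
      · simp [coloredStep, epsilon, Pi.single_apply, ha, hb]

end Gassner

/-! ### Primitivity and the coefficient rings -/

/-- A representation is primitive if its space is not the internal direct sum of `r ≥ 2` nonzero
free submodules that are permuted by the group. -/
def IsPrimitiveRep {R G V : Type*} [CommRing R] [Group G] [AddCommGroup V] [Module R V]
    (ρ : Representation R G V) : Prop :=
  ¬ ∃ (r : ℕ) (W : Fin r → Submodule R V), 2 ≤ r ∧ DirectSum.IsInternal W ∧
    (∀ i, W i ≠ ⊥) ∧ (∀ i, Module.Free R (W i)) ∧
    ∀ g : G, ∃ π : Equiv.Perm (Fin r), ∀ i, (W i).map (ρ g) = W (π i)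

/-- The coefficient rings `E_q`: a field with `q ^ 2` elements (the unitary case), or the ring
`F × F` for a field `F` with `q` elements (the linear case). -/
def IsCoefficientRing.{u} (q : ℕ) (E : Type u) [CommRing E] : Prop :=
  (IsField E ∧ Nat.card E = q ^ 2) ∨
  ∃ (F : Type u) (_ : Field F), Nat.card F = q ∧ Nonempty (E ≃+* F × F)

/-! ### A criterion for primitivity -/

/-! The image contains a transvection `x ↦ x + φ x • w`, and a system of imprimitivity must keep its
direction inside one block. Let `φ` be the last coordinate. The full twist of the strands `0, …, n`
acts on the first `n + 1` coordinates as the scalar `∏ t_i` plus a rank one term that sees only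
their sum. That product is 1 and the sum is `-φ`, so a transvection remains (`gassner_fullTwist`).
The coordinate of `w` at strand 0 is `t_0 - 1`, a unit.

Suppose a block contains `u` with `φ u = 1`. Then `u`, `τ u`, `τ² u` form an arithmetic progression.
If `τ` moved the block, `2 τ u = u + τ² u` would lie both in the block of `τ u` and in the sum of
the others, which is impossible when 2 is invertible. So the block is stable and contains `w`; hence
exactly one block is not inside `ker φ`.

Conjugates `A j` of `s_j²` that wind the last strand around strand `j` (`exists_pure_braid_last`)
satisfy, on `ker φ`, that `φ (A j x)` is a unit times the coordinate `x j`, and that `A j` fixes `x`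
when this vanishes. They preserve the block of `w`, so every other block is killed by `φ` and by all
`φ ∘ A j`, and is therefore zero.

Over `F × F` the argument runs on the part cut out by an idempotent `e` for which `e R` is a field;
freeness of the blocks ensures that a nonzero block has a nonzero `e`-part. -/

theorem isPrimitiveRep_of_transvection {R G V ι : Type*} [CommRing R] [Group G] [AddCommGroup V]
    [Module R V] (ρ : Representation R G V) (e : R) (he : e * e = e)
    (hfield : ∀ x : R, e * x ≠ 0 → ∃ y, y * x = e) (h2 : e * 2 ≠ 0)
    (φ : V →ₗ[R] R) (w : V) (hw : e • w ≠ 0) (hφ : ∃ v, φ v = 1) (hφw : φ w = 0)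
    (τ : G) (hτ : ∀ x, ρ τ x = x + φ x • w) (A : ι → G)
    (hfix : ∀ j x, φ x = 0 → φ (ρ (A j) x) = 0 → ρ (A j) x = x)
    (hker : ∀ x, φ x = 0 → (∀ j, φ (ρ (A j) x) = 0) → x = 0) :
    IsPrimitiveRep ρ := by
  rintro ⟨r, W, hr, hint, hne, hfree, hperm⟩
  have he0 : e ≠ 0 := fun h => h2 (by simp [h])
  have : Nontrivial R := ⟨e, 0, he0⟩
  have hind := hint.submodule_iSupIndep
  have huniq : ∀ {i k x}, x ∈ W i → x ∈ W k → x ≠ 0 → i = k := by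
    intro i k x hi hk hx
    by_contra hik
    exact hx (Submodule.disjoint_def.1 (hind.pairwiseDisjoint hik) x hi hk)
  obtain ⟨c2, hc2⟩ := hfield 2 h2
  have hmem : ∀ i, ∀ x ∈ W i, e * φ x ≠ 0 → e • w ∈ W i := by
    intro i x hx hφx
    obtain ⟨c, hc⟩ := hfield _ hφx
    obtain ⟨π, hπ⟩ := hperm τ
    have hmap : ∀ {k v}, v ∈ W k → ρ τ v ∈ W (π k) := fun {k v} hv => by
      rw [← hπ]; exact Submodule.mem_map_of_mem hv
    -- Rescaled so that `e • u = u` and `φ u = e`, the unit of the field `e R`.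
    set u := (e * c) • x with hu
    have hui : u ∈ W i := (W i).smul_mem _ hx
    have heu : e • u = u := by rw [hu, smul_smul, ← mul_assoc, he]
    have hφu : φ u = e := by rw [hu, map_smul, smul_eq_mul, mul_assoc, hc, he]
    have h1 : ρ τ u = u + e • w := by rw [hτ, hφu]
    have h1' : ρ τ (ρ τ u) = u + (2 : R) • e • w := by
      rw [h1, hτ, map_add, hφu, map_smul φ e w, hφw, smul_zero, add_zero, two_smul, add_assoc]
    have m1 := hmap hui
    have m2 := hmap m1
    by_cases hi : π i = i
    · rw [hi, h1] at m1
      simpa using (W i).sub_mem m1 hui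
    · exfalso
      -- The middle term of the progression lies in the block `π i`, the outer two in other blocks;
      -- independence forces `2 τ u = 0`.
      have h3 : (2 : R) • ρ τ u = u + ρ τ (ρ τ u) := by
        rw [h1', h1, smul_add, two_smul R u, add_assoc]
      have h4 : (2 : R) • ρ τ u ∈ ⨆ k, ⨆ (_ : k ≠ π i), W k := by
        rw [h3]
        refine Submodule.add_mem _ ?_ ?_
        · exact Submodule.mem_iSup_of_mem i (Submodule.mem_iSup_of_mem (Ne.symm hi) hui)
        · exact Submodule.mem_iSup_of_mem (π (π i))
            (Submodule.mem_iSup_of_mem (fun h => hi (π.injective h)) m2)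
      have h5 := Submodule.disjoint_def.1 (hind (π i)) _ ((W (π i)).smul_mem 2 m1) h4
      have h6 : ρ τ u = 0 := by
        have : e • ρ τ u = 0 := by rw [← hc2, mul_smul, h5, smul_zero]
        rwa [← map_smul, heu] at this
      have h7 : u = 0 := by
        have := ρ.inv_self_apply τ u
        rw [h6, map_zero] at this
        exact this.symm
      rw [h7, map_zero] at hφu
      exact he0 hφu.symm
  obtain ⟨i₀, x₀, hx₀, hφx₀⟩ : ∃ i, ∃ x ∈ W i, e * φ x ≠ 0 := by
    by_contra! hcon
    have hle : ⨆ i, W i ≤ LinearMap.ker (e • φ) := iSup_le fun i x hx => by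
      simpa using hcon i x hx
    rw [hint.submodule_iSup_eq_top] at hle
    obtain ⟨v, hv⟩ := hφ
    have := hle (Submodule.mem_top (x := v))
    simp [hv] at this
    exact he0 this
  have hw₀ := hmem i₀ x₀ hx₀ hφx₀
  have hzero : ∀ i, i ≠ i₀ → ∀ x ∈ W i, e • x = x → φ x = 0 := by
    intro i hi x hx hex
    by_contra h
    refine hi (huniq (hmem i x hx ?_) hw₀ hw)
    rwa [← smul_eq_mul, ← map_smul, hex]
  have hφew : φ (e • w) = 0 := by rw [map_smul, hφw, smul_zero]
  have heew : e • e • w = e • w := by rw [smul_smul, he]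
  choose π hπ using fun j => hperm (A j)
  have hmap : ∀ {j k v}, v ∈ W k → ρ (A j) v ∈ W (π j k) := fun {j k v} hv => by
    rw [← hπ]; exact Submodule.mem_map_of_mem hv
  -- If `A j` moved the block of `e • w`, the image of `e • w` would lie in `ker φ`; then `hfix`
  -- says that `e • w` is fixed and so lies in two blocks.
  have hπ₀ : ∀ j, π j i₀ = i₀ := by
    intro j
    by_contra h
    have h1 := hzero _ h _ (hmap hw₀) (by rw [← map_smul, heew])
    have h2 := hfix j _ hφew h1
    have h3 := hmap (j := j) hw₀
    rw [h2] at h3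
    exact h (huniq h3 hw₀ hw)
  obtain ⟨k, hk⟩ : ∃ k, k ≠ i₀ := by
    have : Nontrivial (Fin r) := Fin.nontrivial_iff_two_le.2 hr
    exact exists_ne i₀
  have := hfree k
  have : Nontrivial (W k) := Submodule.nontrivial_iff_ne_bot.2 (hne k)
  let b := Module.Free.chooseBasis R (W k)
  obtain ⟨l⟩ := b.index_nonempty
  -- Freeness enters here: `e` cannot annihilate a basis vector.
  have hbl : e • (b l : V) ≠ 0 := by
    intro h
    have h' : e • b l = 0 := Subtype.ext h
    have := congrArg (fun v => b.repr v l) h'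
    simp at this
    exact he0 this
  have hmemk : e • (b l : V) ∈ W k := (W k).smul_mem _ (b l).2
  have hee : e • e • (b l : V) = e • (b l : V) := by rw [smul_smul, he]
  refine hbl (hker _ (hzero k hk _ hmemk hee) fun j => ?_)
  refine hzero (π j k) ?_ _ (hmap hmemk) (by rw [← map_smul, hee])
  intro h
  rw [← hπ₀ j] at h
  exact hk ((π j).injective h)

theorem two_ne_zero_of_odd_card {F : Type*} [Field F] (h : Odd (Nat.card F)) : (2 : F) ≠ 0 := by
  intro h2
  obtain ⟨k, hk⟩ := h
  have h0 : (Nat.card F : F) = 0 := by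
    have := card_nsmul_eq_zero' (x := (1 : F))
    simpa using this
  rw [hk] at h0
  push_cast at h0
  rw [h2] at h0
  simp at h0

/-- Take `e = 1` in the field case and `e = (1, 0)` in `F × F`; odd cardinality makes 2 nonzero. -/
theorem IsCoefficientRing.exists_idempotent {E : Type*} [CommRing E] {q : ℕ} (hq : Odd q)
    (hE : IsCoefficientRing q E) :
    ∃ e : E, e * e = e ∧ (∀ x : E, e * x ≠ 0 → ∃ y, y * x = e) ∧ e * 2 ≠ 0 := by
  rcases hE with ⟨hf, hcard⟩ | ⟨F, _, hcard, ⟨f⟩⟩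
  · let _ := hf.toField
    have h2 : (2 : E) ≠ 0 := two_ne_zero_of_odd_card (F := E) (by rw [hcard]; exact hq.pow)
    exact ⟨1, by simp, fun x hx => ⟨x⁻¹, inv_mul_cancel₀ (by simpa using hx)⟩, by simpa using h2⟩
  · have h2 : (2 : F) ≠ 0 := two_ne_zero_of_odd_card (by rwa [hcard])
    refine ⟨f.symm (1, 0), ?_, fun x hx => ⟨f.symm ((f x).1⁻¹, 0), ?_⟩, fun h => ?_⟩
    · rw [← map_mul]; simp
    · apply f.injective
      have h1 : (f x).1 ≠ 0 := by
        intro h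
        apply hx
        apply f.injective
        ext <;> simp [h]
      ext <;> simp [h1]
    · have := congrArg (fun x => (f x).1) h
      simp [map_ofNat] at this
      exact h2 this

/-! ### The action of the generators -/

section Generators

variable {R : Type*} [CommRing R] {m : ℕ}

theorem braidPerm_of (i : Fin m) :
    braidPerm m (PresentedGroup.of i) = Equiv.swap i.castSucc i.succ :=
  PresentedGroup.toGroup.of _

theorem coloredBurau_of (i : Fin m) (x : ColoredVec R (Fin (m + 1))) :
    coloredBurau R m (PresentedGroup.of i) x = (x.1 ∘ Equiv.swap i.castSucc i.succ, fun k =>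
      if k = i.castSucc then (1 - x.1 i.succ) * x.2 i.castSucc + x.2 i.succ
      else if k = i.succ then x.1 i.succ * x.2 i.castSucc else x.2 k) := by
  have h1 : coloredBurau R m (PresentedGroup.of i) =
      coloredStep i.castSucc i.succ i.castSucc_lt_succ.ne := PresentedGroup.toGroup.of _
  rw [h1]; rfl

/-- A strand with coordinate zero can be carried to the right past others without changing their
coordinates. -/
theorem coloredBurau_of_of_eq_zero (i : Fin m) (c : Fin (m + 1) → Rˣ) (y : Fin (m + 1) → R)
    (h : y i.castSucc = 0) :
    coloredBurau R m (PresentedGroup.of i) (c, y) =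
      (c ∘ Equiv.swap i.castSucc i.succ, y ∘ Equiv.swap i.castSucc i.succ) := by
  rw [coloredBurau_of]
  refine Prod.ext rfl (funext fun k => ?_)
  simp only [Function.comp_apply, Equiv.swap_apply_def]
  split_ifs <;> simp [h]

/-! ### Winding the last strand around another strand -/

theorem insertNth_castSucc_comp_swap {α : Type*} (i : Fin m) (a : α) (d : Fin m → α) :
    (Fin.insertNth i.castSucc a d : Fin (m + 1) → α) ∘ Equiv.swap i.castSucc i.succ =
      Fin.insertNth i.succ a d := by
  funext k
  rcases Fin.eq_self_or_eq_succAbove i.succ k with rfl | ⟨l, rfl⟩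
  · simp
  · rw [Fin.insertNth_apply_succAbove, Function.comp_apply]
    by_cases hl : l = i
    · subst hl
      rw [Fin.succAbove_succ_self, Equiv.swap_apply_left]
      conv_lhs => rw [← Fin.succAbove_castSucc_self l]
      rw [Fin.insertNth_apply_succAbove]
    · have h1 : i.succ.succAbove l = i.castSucc.succAbove l := by
        rcases lt_or_gt_of_ne hl with h | h
        · rw [Fin.succAbove_of_castSucc_lt _ _ (by rw [Fin.lt_def] at *; simp; omega),
            Fin.succAbove_of_castSucc_lt _ _ (by rw [Fin.lt_def] at *; simp; omega)]
        · rw [Fin.succAbove_of_le_castSucc _ _ (by rw [Fin.lt_def] at *; rw [Fin.le_def]; simp; omega),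
            Fin.succAbove_of_le_castSucc _ _ (by rw [Fin.lt_def] at *; rw [Fin.le_def]; simp; omega)]
      rw [Equiv.swap_apply_of_ne_of_ne (by rw [h1]; exact Fin.succAbove_ne _ _)
        (Fin.succAbove_ne _ _), h1, Fin.insertNth_apply_succAbove]

/-- Some braid moves the strand `k` to the last place, without disturbing the coordinates if the
coordinate of that strand is zero. -/
theorem exists_braid_to_last (R : Type*) [CommRing R] (k : Fin (m + 1)) :
    ∃ g : BraidGroup m,
      (∀ (a : Rˣ) d (z : Fin m → R), coloredBurau R m g
        (Fin.insertNth k a d, Fin.insertNth k 0 z) =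
          (Fin.insertNth (Fin.last m) a d, Fin.insertNth (Fin.last m) 0 z)) ∧
      ∀ c : Fin (m + 1) → Rˣ, ∃ v : Rˣ, ∀ y,
        (coloredBurau R m g (c, y)).2 (Fin.last m) = v * y k := by
  induction k using Fin.reverseInduction with
  | last => exact ⟨1, by simp, fun c => ⟨1, by simp⟩⟩
  | cast i ih =>
    obtain ⟨g, h1, h2⟩ := ih
    -- The rightmost letter acts first: it moves the strand from `i` to `i + 1`, where the induction
    -- hypothesis takes over.
    refine ⟨g * PresentedGroup.of i, fun a d z => ?_, fun c => ?_⟩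
    · rw [map_mul, Equiv.Perm.mul_apply, coloredBurau_of_of_eq_zero _ _ _ (by simp),
        insertNth_castSucc_comp_swap, insertNth_castSucc_comp_swap, h1]
    · obtain ⟨v, hv⟩ := h2 (c ∘ Equiv.swap i.castSucc i.succ)
      refine ⟨v * c i.succ, fun y => ?_⟩
      rw [map_mul, Equiv.Perm.mul_apply, coloredBurau_of, hv]
      simp [mul_assoc, i.castSucc_lt_succ.ne']

/-- Carry the last strand, of coordinate zero, next to strand `j`, apply `s_j²`, and carry it back.
The double crossing gives it the coordinate `t_j (1 - t_last) y_j`, a unit multiple of `y_j`; if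
`y_j = 0`, both crossings are mere swaps and cancel. -/
theorem exists_pure_braid_last (t : Fin (m + 1) → Rˣ)
    (hlast : IsUnit ((t (Fin.last m) : R) - 1)) (j : Fin m) :
    ∃ A : PureBraidGroup m, ∃ v : Rˣ, ∀ y, y (Fin.last m) = 0 →
      gassner t A y (Fin.last m) = v * y j.castSucc ∧
      (y j.castSucc = 0 → gassner t A y = y) := by
  obtain ⟨g, h1, h2⟩ := exists_braid_to_last (R := R) j.succ
  let A : PureBraidGroup m := ⟨g * PresentedGroup.of j ^ 2 * g⁻¹,
    (inferInstance : (braidPerm m).ker.Normal).conj_mem _ (pureGen j).2 g⟩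
  let a := t (Fin.last m)
  let d : Fin m → Rˣ := fun i => t i.castSucc
  let c : Fin (m + 1) → Rˣ := Fin.insertNth j.succ a d
  have ht : Fin.insertNth (Fin.last m) a d = t := by
    funext k
    refine Fin.lastCases ?_ (fun i => ?_) k
    · simp [a]
    · simp [d, Fin.insertNth_last']
  have hcj : c j.castSucc = d j := by
    conv_lhs => rw [← Fin.succAbove_succ_self j]
    exact Fin.insertNth_apply_succAbove _ _ _ _
  have hcj' : c j.succ = a := by simp [c]
  obtain ⟨v, hv⟩ := h2 c
  obtain ⟨u, hu⟩ : IsUnit (-((t (Fin.last m) : R) - 1)) := hlast.neg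
  have key : ∀ y : Fin (m + 1) → R, y (Fin.last m) = 0 →
      gassner t A y = (coloredBurau R m g (coloredBurau R m (PresentedGroup.of j)
        (coloredBurau R m (PresentedGroup.of j)
          (c, Fin.insertNth j.succ 0 fun i => y i.castSucc)))).2 := by
    intro y hy
    have hy' : Fin.insertNth (Fin.last m) 0 (fun i => y i.castSucc) = y := by
      funext k
      refine Fin.lastCases ?_ (fun i => ?_) k
      · simp [hy]
      · simp [Fin.insertNth_last']
    have h3 := h1 a d (fun i => y i.castSucc)
    rw [ht, hy'] at h3
    change (coloredBurau R m (g * PresentedGroup.of j ^ 2 * g⁻¹) (t, y)).2 = _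
    rw [← h3, ← Equiv.Perm.mul_apply, ← map_mul, inv_mul_cancel_right, pow_two]
    simp only [map_mul, Equiv.Perm.mul_apply]
    rfl
  refine ⟨A, v * (d j * u), fun y hy => ?_⟩
  have hzj : (Fin.insertNth j.succ 0 (fun i : Fin m => y i.castSucc) : Fin (m + 1) → R)
      j.castSucc = y j.castSucc := by
    conv_lhs => rw [← Fin.succAbove_succ_self j]
    exact Fin.insertNth_apply_succAbove _ _ _ _
  constructor
  · rw [key y hy, coloredBurau_of j (c, _)]
    rw [coloredBurau_of]
    have hc : (c ∘ Equiv.swap j.castSucc j.succ) ∘ Equiv.swap j.castSucc j.succ = c := by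
      funext k; simp
    simp only [hc]
    rw [hv]
    have hne : j.succ ≠ j.castSucc := j.castSucc_lt_succ.ne'
    simp only [hne, if_true, if_false, Function.comp_apply, Equiv.swap_apply_right, hcj, hcj', hzj,
      Fin.insertNth_apply_same, Units.val_mul, hu, a]
    ring
  · intro h0
    rw [key y hy, coloredBurau_of_of_eq_zero _ _ _ (hzj.trans h0),
      coloredBurau_of_of_eq_zero _ _ _ (by simp)]
    have hc : ∀ {α : Type _} (f : Fin (m + 1) → α),
        (f ∘ Equiv.swap j.castSucc j.succ) ∘ Equiv.swap j.castSucc j.succ = f := by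
      intro α f; funext k; simp
    rw [hc, hc, h1]
    funext k
    refine Fin.lastCases ?_ (fun i => ?_) k
    · simp [hy]
    · simp [Fin.insertNth_last']

end Generators

/-! ### The full twist of all strands but the last -/

/-- The braid `s 0 * s 1 * ⋯ * s (k - 1)`, which moves the strand `k` to the place `0`. -/
def cycleBraid (m : ℕ) : ℕ → BraidGroup m
  | 0 => 1
  | k + 1 => if h : k < m then cycleBraid m k * PresentedGroup.of ⟨k, h⟩ else cycleBraid m k

section FullTwist

variable {R : Type*} [CommRing R] {m : ℕ}

theorem cycleBraid_succ (j : Fin m) :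
    cycleBraid m (j + 1) = cycleBraid m j * PresentedGroup.of j := by
  simp [cycleBraid]

theorem braidPerm_cycleBraid (k : Fin (m + 1)) :
    (braidPerm m (cycleBraid m k))⁻¹ 0 = k ∧ ∀ i : Fin m,
      (braidPerm m (cycleBraid m k))⁻¹ i.succ = if i.castSucc < k then i.castSucc else i.succ := by
  induction k using Fin.induction with
  | zero => simp [cycleBraid]
  | succ j ih =>
    rw [Fin.val_succ, cycleBraid_succ, map_mul, mul_inv_rev, braidPerm_of, Equiv.swap_inv]
    simp only [Equiv.Perm.mul_apply]
    rw [Fin.val_castSucc] at ih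
    refine ⟨by rw [ih.1, Equiv.swap_apply_left], fun i => ?_⟩
    rw [ih.2]
    rcases lt_trichotomy i j with h | rfl | h
    · have h1 : i.castSucc < j.castSucc := h
      have h2 : i.castSucc < j.succ := h1.trans j.castSucc_lt_succ
      rw [if_pos h1, if_pos h2, Equiv.swap_apply_of_ne_of_ne h1.ne h2.ne]
    · rw [if_neg (lt_irrefl _), if_pos i.castSucc_lt_succ, Equiv.swap_apply_right]
    · have h1 : j.castSucc < i.castSucc := h
      have h2 : j.succ ≤ i.castSucc := h
      have h3 : j.succ < i.succ := Fin.succ_lt_succ_iff.2 h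
      rw [if_neg h1.not_gt, if_neg h2.not_gt,
        Equiv.swap_apply_of_ne_of_ne (h1.trans i.castSucc_lt_succ).ne' h3.ne']

/-- Each strand passed by strand `k` shifts by one place and is multiplied by the color `c k`. Place
0 is omitted: it follows from the preserved coordinate sum. -/
theorem coloredBurau_cycleBraid (k : Fin (m + 1)) (c : Fin (m + 1) → Rˣ) (y : Fin (m + 1) → R)
    (i : Fin m) :
    (coloredBurau R m (cycleBraid m k) (c, y)).2 i.succ =
      if i.castSucc < k then c k * y i.castSucc else y i.succ := by
  induction k using Fin.induction generalizing c y with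
  | zero => simp [cycleBraid]
  | succ j ih =>
    rw [Fin.val_castSucc] at ih
    rw [Fin.val_succ, cycleBraid_succ, map_mul, Equiv.Perm.mul_apply, coloredBurau_of, ih]
    have hne := j.castSucc_lt_succ.ne'
    simp only [Function.comp_apply, Equiv.swap_apply_left]
    rcases lt_trichotomy i j with h | rfl | h
    · have h1 : i.castSucc < j.castSucc := h
      have h2 : i.castSucc < j.succ := h1.trans j.castSucc_lt_succ
      rw [if_pos h1, if_pos h2, if_neg h1.ne, if_neg h2.ne]
    · rw [if_neg (lt_irrefl _), if_pos i.castSucc_lt_succ, if_neg hne, if_pos rfl]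
    · have h1 : j.castSucc < i.castSucc := h
      have h2 : j.succ ≤ i.castSucc := h
      have h3 : j.succ < i.succ := Fin.succ_lt_succ_iff.2 h
      rw [if_neg h1.not_gt, if_neg h2.not_gt, if_neg (h1.trans i.castSucc_lt_succ).ne',
        if_neg h3.ne']

end FullTwist

section FullTwistAction

/-! ### Powers of the cycle braid, with places `0, …, n` read modulo `n + 1`. -/

open scoped Fin.CommRing

variable {R : Type*} [CommRing R] {n : ℕ}

theorem Fin.last_eq_neg_one : Fin.last n = -1 :=
  eq_neg_of_add_eq_zero_left (Fin.last_add_one n)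

theorem braidPerm_cycleBraid_castSucc (i : Fin (n + 1)) :
    (braidPerm (n + 1) (cycleBraid (n + 1) n))⁻¹ i.castSucc = (i - 1).castSucc := by
  obtain ⟨h1, h2⟩ := braidPerm_cycleBraid (m := n + 1) (Fin.last n).castSucc
  simp only [Fin.val_castSucc, Fin.val_last] at h1 h2
  induction i using Fin.cases with
  | zero => rw [Fin.castSucc_zero, h1, zero_sub, Fin.last_eq_neg_one]
  | succ i =>
    have hi : i.succ - 1 = i.castSucc := by rw [← Fin.coeSucc_eq_succ, add_sub_cancel_right]
    rw [hi, ← Fin.succ_castSucc, h2, if_pos]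
    exact Fin.castSucc_lt_last i

theorem braidPerm_cycleBraid_last :
    (braidPerm (n + 1) (cycleBraid (n + 1) n))⁻¹ (Fin.last (n + 1)) = Fin.last (n + 1) := by
  have h2 := (braidPerm_cycleBraid (m := n + 1) (Fin.last n).castSucc).2 (Fin.last n)
  simpa using h2

theorem coloredBurau_cycleBraid_last (c : Fin (n + 2) → Rˣ) (y : Fin (n + 2) → R) :
    (coloredBurau R (n + 1) (cycleBraid (n + 1) n) (c, y)).2 (Fin.last (n + 1)) =
      y (Fin.last (n + 1)) := by
  have h2 := coloredBurau_cycleBraid (m := n + 1) (Fin.last n).castSucc c y (Fin.last n)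
  simpa using h2

theorem coloredBurau_cycleBraid_castSucc (c : Fin (n + 2) → Rˣ) (y : Fin (n + 2) → R)
    (i : Fin (n + 1)) :
    (coloredBurau R (n + 1) (cycleBraid (n + 1) n) (c, y)).2 i.castSucc =
      c (Fin.last n).castSucc * y (i - 1).castSucc +
        if i = 0 then (1 - c (Fin.last n).castSucc) * ∑ k : Fin (n + 1), y k.castSucc else 0 := by
  have h := coloredBurau_cycleBraid (m := n + 1) (Fin.last n).castSucc c y
  simp only [Fin.val_castSucc, Fin.val_last] at h
  have hs : ∀ i : Fin n,
      (coloredBurau R (n + 1) (cycleBraid (n + 1) n) (c, y)).2 i.succ.castSucc =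
        c (Fin.last n).castSucc * y i.castSucc.castSucc := by
    intro i
    rw [← Fin.succ_castSucc, h, if_pos]
    exact Fin.castSucc_lt_last i
  induction i using Fin.cases with
  | zero =>
    -- The coordinate at place 0 is whatever the preserved sum leaves over.
    have hsum := (coloredBurau_spec (cycleBraid (n + 1) n)).2.2 c y
    rw [Fin.sum_univ_castSucc, Fin.sum_univ_castSucc y, coloredBurau_cycleBraid_last,
      add_left_inj, Fin.sum_univ_succ] at hsum
    simp only [hs] at hsum
    rw [← Finset.mul_sum] at hsum
    have h0 : (0 - 1 : Fin (n + 1)) = Fin.last n := by rw [zero_sub, Fin.last_eq_neg_one]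
    rw [eq_sub_of_add_eq hsum, h0, if_pos rfl, Fin.sum_univ_castSucc]
    ring
  | succ i =>
    have hi : i.succ - 1 = i.castSucc := by rw [← Fin.coeSucc_eq_succ, add_sub_cancel_right]
    rw [hs, hi, if_neg (Fin.succ_ne_zero i), add_zero]

/-- The coefficients of the translation part of the powers of `cycleBraid`. -/
def twistVector (d : Fin (n + 1) → R) : ℕ → Fin (n + 1) → R
  | 0 => 0
  | k + 1 => fun i => d (-1 - k) * twistVector d k (i - 1) + if i = 0 then 1 - d (-1 - k) else 0

theorem twistVector_succ (d : Fin (n + 1) → R) (k : ℕ) (i : Fin (n + 1)) :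
    twistVector d (k + 1) i =
      d (-1 - k) * twistVector d k (i - 1) + if i = 0 then 1 - d (-1 - k) else 0 :=
  rfl

/-- The inhomogeneous term enters at place 0 and advances one place per step, so it has not yet
reached place `i`. -/
theorem twistVector_eq_zero (d : Fin (n + 1) → R) (k : ℕ) (i : Fin (n + 1)) (h : k ≤ i) :
    twistVector d k i = 0 := by
  induction k generalizing i with
  | zero => rfl
  | succ k ih =>
    have hi : i ≠ 0 := fun hi => by simp [hi] at h
    have h1 : k ≤ (i - 1 : Fin (n + 1)) := by
      rw [Fin.val_sub_one_of_ne_zero hi]; omega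
    rw [twistVector_succ, ih _ h1, if_neg hi]
    simp

/-- After `n` steps place `n` is still zero, so the final shift brings nothing to place 0; only the
last inhomogeneous term, of color `-1 - n = 0`, remains. -/
theorem twistVector_zero (d : Fin (n + 1) → R) : twistVector d (n + 1) 0 = 1 - d 0 := by
  have h0 : (0 - 1 : Fin (n + 1)) = Fin.last n := by rw [zero_sub, Fin.last_eq_neg_one]
  have h1 : (-1 - (n : Fin (n + 1))) = 0 := by
    rw [← Fin.last_eq_neg_one, sub_eq_zero]; simp
  rw [twistVector_succ, h0, twistVector_eq_zero _ _ _ (by simp), h1]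
  simp

/-- The last coordinate and the total sum are fixed, so the sum of the others is the same at every
step and factors out of the translation part. -/
theorem coloredBurau_cycleBraid_pow (c : Fin (n + 2) → Rˣ) (y : Fin (n + 2) → R) (k : ℕ) :
    (∀ i : Fin (n + 1), (coloredBurau R (n + 1) (cycleBraid (n + 1) n ^ k) (c, y)).1 i.castSucc =
      c (i - k).castSucc) ∧
    (coloredBurau R (n + 1) (cycleBraid (n + 1) n ^ k) (c, y)).2 (Fin.last (n + 1)) =
      y (Fin.last (n + 1)) ∧
    ∀ i : Fin (n + 1), (coloredBurau R (n + 1) (cycleBraid (n + 1) n ^ k) (c, y)).2 i.castSucc =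
      (∏ l ∈ Finset.range k, (c (-1 - (l : Fin (n + 1))).castSucc : R)) * y (i - k).castSucc +
        (∑ l : Fin (n + 1), y l.castSucc) * twistVector (fun l => (c l.castSucc : R)) k i := by
  induction k with
  | zero => simp [twistVector]
  | succ k ih =>
    obtain ⟨h1, h2, h3⟩ := ih
    have hsum := (coloredBurau_spec (cycleBraid (n + 1) n ^ k)).2.2 c y
    rw [Fin.sum_univ_castSucc, Fin.sum_univ_castSucc y, h2, add_left_inj] at hsum
    set x := coloredBurau R (n + 1) (cycleBraid (n + 1) n ^ k) (c, y) with hx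
    have hpow : coloredBurau R (n + 1) (cycleBraid (n + 1) n ^ (k + 1)) (c, y) =
        coloredBurau R (n + 1) (cycleBraid (n + 1) n) (x.1, x.2) := by
      rw [pow_succ', map_mul, Equiv.Perm.mul_apply]
    rw [hpow]
    refine ⟨fun i => ?_, ?_, fun i => ?_⟩
    · rw [(coloredBurau_spec _).1, Function.comp_apply, braidPerm_cycleBraid_castSucc, h1]
      push_cast
      rw [sub_sub, add_comm (1 : Fin (n + 1))]
    · rw [coloredBurau_cycleBraid_last, h2]
    · have hlast : Fin.last n = -1 := Fin.last_eq_neg_one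
      have hik : i - ((k + 1 : ℕ) : Fin (n + 1)) = i - 1 - k := by
        push_cast; rw [sub_sub, add_comm (1 : Fin (n + 1))]
      rw [coloredBurau_cycleBraid_castSucc, h1, hsum, h3, hlast, Finset.prod_range_succ, hik,
        twistVector_succ]
      split_ifs <;> ring

theorem cycleBraid_pow_mem : cycleBraid (n + 1) n ^ (n + 1) ∈ PureBraidGroup (n + 1) := by
  rw [MonoidHom.mem_ker, map_pow, ← inv_eq_one, ← inv_pow]
  have key : ∀ (k : ℕ) (i : Fin (n + 1)),
      ((braidPerm (n + 1) (cycleBraid (n + 1) n))⁻¹ ^ k) i.castSucc = (i - k).castSucc := by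
    intro k i
    induction k with
    | zero => simp
    | succ k ih =>
      rw [pow_succ', Equiv.Perm.mul_apply, ih, braidPerm_cycleBraid_castSucc]
      push_cast
      rw [sub_sub]
  ext i : 1
  induction i using Fin.lastCases with
  | last => exact Function.IsFixedPt.perm_pow braidPerm_cycleBraid_last _
  | cast i => rw [key]; simp

/-- The full twist of the strands `0, …, n`. -/
def fullTwist (n : ℕ) : PureBraidGroup (n + 1) := ⟨_, cycleBraid_pow_mem (n := n)⟩

theorem gassner_fullTwist (t : Fin (n + 2) → Rˣ) (y : Fin (n + 2) → R) :
    gassner t (fullTwist n) y (Fin.last (n + 1)) = y (Fin.last (n + 1)) ∧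
    ∀ i : Fin (n + 1), gassner t (fullTwist n) y i.castSucc =
      (∏ l : Fin (n + 1), (t l.castSucc : R)) * y i.castSucc +
        (∑ l : Fin (n + 1), y l.castSucc) *
          twistVector (fun l => (t l.castSucc : R)) (n + 1) i := by
  obtain ⟨-, h2, h3⟩ := coloredBurau_cycleBraid_pow t y (n + 1)
  refine ⟨h2, fun i => (h3 i).trans ?_⟩
  have hp : ∏ l ∈ Finset.range (n + 1), (t (-1 - (l : Fin (n + 1))).castSucc : R) =
      ∏ l : Fin (n + 1), (t l.castSucc : R) := by
    rw [← Fin.prod_univ_eq_prod_range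
      (fun l => (t (-1 - (l : Fin (n + 1))).castSucc : R)) (n + 1)]
    simp only [Fin.cast_val_eq_self]
    -- In `n + 1` steps the passing color `-1 - l` runs once through all places.
    exact (Equiv.subLeft (-1 : Fin (n + 1))).prod_comp fun l => (t l.castSucc : R)
  rw [hp]
  simp

end FullTwistAction

/-! ### Verification of the criterion for the reduced Gassner representation. -/

theorem mainTheorem6 {E : Type*} [CommRing E] (q : ℕ) (hq : Odd q)
    (hE : IsCoefficientRing q E) (n : ℕ) (hn : 2 < n) (t : Fin (n + 2) → Eˣ)
    (hprod : ∏ i : Fin (n + 1), t i.castSucc = 1)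
    (hfirst : IsUnit ((t 0 : E) - 1))
    (hlast : IsUnit ((t (Fin.last (n + 1)) : E) - 1)) :
    IsPrimitiveRep (reducedGassner t) := by
  obtain ⟨e, he, hfield, h2⟩ := hE.exists_idempotent hq
  have he0 : e ≠ 0 := fun h => h2 (by simp [h])
  have hprod' : ∏ l : Fin (n + 1), (t l.castSucc : E) = 1 := by
    rw [← Units.coe_prod, hprod, Units.val_one]
  have hsum : ∀ y : reducedSpace E (n + 1),
      ∑ l : Fin (n + 1), (y : Fin (n + 2) → E) l.castSucc =
        -(y : Fin (n + 2) → E) (Fin.last (n + 1)) := by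
    intro y
    have := mem_reducedSpace.1 y.2
    rw [Fin.sum_univ_castSucc] at this
    exact eq_neg_of_add_eq_zero_left this
  let φ : reducedSpace E (n + 1) →ₗ[E] E :=
    (LinearMap.proj (Fin.last (n + 1))).comp (reducedSpace E (n + 1)).subtype
  have hφε : φ (epsilon E (Fin.last n)) = 1 := by
    simp [φ, epsilon, (Fin.castSucc_lt_last (Fin.last n)).ne']
  -- Since `φ (ε n) = 1`, the direction of the transvection is the displacement of `ε n`.
  let w := reducedGassner t (fullTwist n) (epsilon E (Fin.last n)) - epsilon E (Fin.last n)
  have hτlast : ∀ y, φ (reducedGassner t (fullTwist n) y) = φ y := fun y =>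
    (gassner_fullTwist t y).1
  have hτ : ∀ (y : reducedSpace E (n + 1)) (i : Fin (n + 1)),
      (reducedGassner t (fullTwist n) y - y : Fin (n + 2) → E) i.castSucc =
        -φ y * twistVector (fun l => (t l.castSucc : E)) (n + 1) i := by
    intro y i
    have h := (gassner_fullTwist t y).2 i
    rw [hprod', hsum, one_mul] at h
    exact sub_eq_of_eq_add' h
  choose A v hA using exists_pure_braid_last t hlast
  refine isPrimitiveRep_of_transvection (reducedGassner t) e he hfield h2 φ w ?_ ⟨_, hφε⟩ ?_
    (fullTwist n) ?_ A ?_ ?_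
  · intro h
    have h0 : e * (reducedGassner t (fullTwist n) (epsilon E (Fin.last n)) -
        epsilon E (Fin.last n) : Fin (n + 2) → E) (0 : Fin (n + 1)).castSucc = 0 :=
      congrFun (congrArg Subtype.val h) _
    -- At place 0 the vector `w` has the coordinate `t_0 - 1`, a unit, so `e • w = 0` would give `e
    -- = 0`.
    rw [hτ, hφε, twistVector_zero, neg_one_mul, neg_sub, Fin.castSucc_zero] at h0
    exact he0 ((hfirst.mul_left_eq_zero).1 h0)
  · rw [map_sub, hτlast, sub_self]
  · intro y
    rw [← sub_eq_iff_eq_add']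
    apply Subtype.ext
    funext i
    induction i using Fin.lastCases with
    | last =>
      change φ (_ - y) = φ (φ y • w)
      rw [map_sub, hτlast, map_smul, map_sub, hτlast]
      simp
    | cast i =>
      refine (hτ y i).trans ?_
      change _ = φ y * (reducedGassner t (fullTwist n) (epsilon E (Fin.last n)) -
        epsilon E (Fin.last n) : Fin (n + 2) → E) i.castSucc
      rw [hτ, hφε]
      ring
  · intro j y hy hAy
    obtain ⟨h1, h3⟩ := hA j y hy
    refine Subtype.ext (h3 ?_)
    exact (Units.mul_right_eq_zero _).1 (h1.symm.trans hAy)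
  · intro y hy hAy
    apply Subtype.ext
    funext i
    induction i using Fin.lastCases with
    | last => exact hy
    | cast j => exact (Units.mul_right_eq_zero _).1 ((hA j y hy).1.symm.trans (hAy j))
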